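/- Let $n\ge 0$ and let $A,B$ be complex $n\times n$ matrices. For any complex matrix $Z$ let $\sigma_1(Z)\ge\sigma_2(Z)\ge\cdots$ be its singular values in decreasing order, with multiplicity (and $\sigma_1(Z)=0$ for an empty matrix). The Fan product $A\star B$ is the $n\times n$ matrix with entries $(A\star B)_{ii}=-a_{ii}b_{ii}$ and $(A\star B)_{ij}=a_{ij}b_{ij}$ for $i\ne j$. For $x\in\mathbb{C}^n$ let $\Theta_j(x)$ be the diagonal matrix with diagonal $(x_1,\dots,x_{j-1},-x_j,x_{j+1},\dots,x_n)$. With $a_j$, $b_j$ the $j$-th columns of $A$, $B$, put $$\Phi(A)=\bigl(\Theta_1(a_1)\mid\cdots\mid\Theta_n(a_n)\bigr)\in M_{n\times n^2}(\mathbb{C}),\qquad \Psi(B)=b_1\oplus\cdots\oplus b_n\in M_{n^2\times n}(\mathbb{C}),$$ the latter being the block-diagonal matrix whose diagonal blocks are the columns $b_1,\dots,b_n$. Then: (1) $\operatorname{Tr}\bigl((A\star B)C\bigr)=\operatorname{Tr}\bigl(A(B^T\star C)\bigr)$ for every complex $n\times n$ matrix $C$; (2) $A\star B=\Phi(A)\Psi(B)$,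 with $\sigma_1(\Phi(A))\le\sigma_1(A)$ and $\sigma_1(\Psi(B))\le\sigma_1(B)$; (3) $\sigma_1(A\star B)\le\sigma_1(A)\sigma_1(B)$ and $\sigma_1(A^T\star B)\le\sigma_1(A)\sigma_1(B)$; (4) $\displaystyle\sum_{i=1}^k\sigma_i(A\star B)\le\sum_{i=1}^k\sigma_i(A)\sigma_i(B)$ for all $1\le k\le n$. -/

import Mathlib

open Matrix

noncomputable section

/-- The singular values of a complex matrix, in decreasing order and with multiplicity (those of
the linear map between Euclidean spaces given by the matrix), indexed from zero: `sigma A i` is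
the singular value usually written `σ_{i+1}(A)`. -/
def sigma {m n : Type*} [Fintype m] [Fintype n] [DecidableEq n]
    (A : Matrix m n ℂ) (i : ℕ) : ℝ :=
  (Matrix.toEuclideanLin A).singularValues i

/-- The Fan product: the entrywise product with the diagonal entries negated. -/
def fanProduct {n : ℕ} (A B : Matrix (Fin n) (Fin n) ℂ) : Matrix (Fin n) (Fin n) ℂ :=
  Matrix.of fun i j => if i = j then -(A i i * B i i) else A i j * B i j

/-- The diagonal matrix with diagonal `x`, except that the `j`-th entry is negated. -/
def fanTheta {n : ℕ} (j : Fin n) (x : Fin n → ℂ) : Matrix (Fin n) (Fin n) ℂ :=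
  Matrix.diagonal (Function.update x j (-x j))

/-- The `n × n²` block row `(Θ_1(a_1) | ⋯ | Θ_n(a_n))`, with `a_j` the `j`-th column of `A`; the
column index `(j, l)` is the `l`-th column of the `j`-th block. -/
def fanPhi {n : ℕ} (A : Matrix (Fin n) (Fin n) ℂ) : Matrix (Fin n) (Fin n × Fin n) ℂ :=
  Matrix.of fun i p => fanTheta p.1 (fun r => A r p.1) i p.2

/-- The `n² × n` direct sum `b_1 ⊕ ⋯ ⊕ b_n` of the columns of `B`; the row index `(j, l)` is the
`l`-th row of the `j`-th block. -/
def fanPsi {n : ℕ} (B : Matrix (Fin n) (Fin n) ℂ) : Matrix (Fin n × Fin n) (Fin n) ℂ :=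
  Matrix.of fun p m => if p.1 = m then B p.2 p.1 else 0

end

/-! The factorization Φ(A)Ψ(B) gives the norm bound: Φ(A)Φ(A)* and Ψ(B)*Ψ(B) are diagonal, with the
squared row norms of A and column norms of B as entries, and none of these exceeds the squared
operator norm.

For the Ky Fan sums, write the sign pattern as ε_ij. The form ∑ ε_ij a_ij b_ij c_ij is symmetric in
its three arguments. Taking for C the conjugate of ∑_{t<k} x_t y_t*, with x_t, y_t singular vectors
of A ⋆ B, turns it into the sum of the first k singular values. Expanding A and B by their singular
value decompositions gives ∑ σ_p(A) σ_q(B) M_pq. A partial sum of Re M over p < P, q < Q is the real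
part of the form at three contractions that are sums of P, Q and k rank-one terms. By symmetry and
the norm bound it is at most min(P, Q, k), and double Abel summation concludes. -/

/-! ### Bessel's inequality and singular value decomposition -/

section SubOrthonormal

variable {E : Type*} [NormedAddCommGroup E] [InnerProductSpace ℂ E]

/-- Pairwise orthogonal vectors of norm at most one. -/
def SubOrthonormal (w : ℕ → E) : Prop :=
  (∀ p, ‖w p‖ ≤ 1) ∧ ∀ p q, p ≠ q → inner ℂ (w p) (w q) = 0

theorem SubOrthonormal.norm_sum_sq_le {w : ℕ → E} (hw : SubOrthonormal w) (s : Finset ℕ)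
    (a : ℕ → ℂ) : ‖∑ p ∈ s, a p • w p‖ ^ 2 ≤ ∑ p ∈ s, ‖a p‖ ^ 2 := by
  induction s using Finset.induction_on with
  | empty => simp
  | insert p s hp ih =>
    rw [Finset.sum_insert hp, Finset.sum_insert hp, sq,
      norm_add_sq_eq_norm_sq_add_norm_sq_of_inner_eq_zero (𝕜 := ℂ)]
    · have h1 : ‖a p • w p‖ ≤ ‖a p‖ := by
        rw [norm_smul]
        exact mul_le_of_le_one_right (norm_nonneg _) (hw.1 p)
      nlinarith [norm_nonneg (a p • w p)]
    · rw [inner_sum]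
      refine Finset.sum_eq_zero fun q hq => ?_
      rw [inner_smul_left, inner_smul_right, hw.2 p q (by rintro rfl; exact hp hq)]
      simp

theorem SubOrthonormal.sum_norm_inner_sq_le {w : ℕ → E} (hw : SubOrthonormal w) (s : Finset ℕ)
    (x : E) : ∑ p ∈ s, ‖inner ℂ (w p) x‖ ^ 2 ≤ ‖x‖ ^ 2 := by
  have h1 := hw.norm_sum_sq_le s fun p => inner ℂ (w p) x
  have h2 : inner ℂ (∑ p ∈ s, inner ℂ (w p) x • w p) x
      = ((∑ p ∈ s, ‖inner ℂ (w p) x‖ ^ 2 : ℝ) : ℂ) := by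
    rw [sum_inner, Complex.ofReal_sum]
    refine Finset.sum_congr rfl fun p _ => ?_
    rw [inner_smul_left, mul_comm, Complex.mul_conj, Complex.normSq_eq_norm_sq]
  have h3 := norm_inner_le_norm (𝕜 := ℂ) (∑ p ∈ s, inner ℂ (w p) x • w p) x
  have h0 : 0 ≤ ∑ p ∈ s, ‖inner ℂ (w p) x‖ ^ 2 := Finset.sum_nonneg fun _ _ => sq_nonneg _
  rw [h2, Complex.norm_real, Real.norm_of_nonneg h0] at h3
  -- With S the sum and y the projected vector, 2S ≤ 2‖y‖‖x‖ ≤ ‖y‖² + ‖x‖² ≤ S + ‖x‖².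
  nlinarith [sq_nonneg (‖∑ p ∈ s, inner ℂ (w p) x • w p‖ - ‖x‖)]

theorem SubOrthonormal.norm_sum_inner_smul_le {F : Type*} [NormedAddCommGroup F]
    [InnerProductSpace ℂ F] {u : ℕ → F} {v : ℕ → E} (hu : SubOrthonormal u)
    (hv : SubOrthonormal v) (s : Finset ℕ) (c : ℕ → ℝ) {K : ℝ} (hK : 0 ≤ K)
    (hc : ∀ p ∈ s, |c p| ≤ K) (x : E) :
    ‖∑ p ∈ s, (c p : ℂ) • inner ℂ (v p) x • u p‖ ≤ K * ‖x‖ := by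
  refine le_of_sq_le_sq ?_ (by positivity)
  calc ‖∑ p ∈ s, (c p : ℂ) • inner ℂ (v p) x • u p‖ ^ 2
      = ‖∑ p ∈ s, ((c p : ℂ) * inner ℂ (v p) x) • u p‖ ^ 2 := by simp only [smul_smul]
    _ ≤ ∑ p ∈ s, ‖(c p : ℂ) * inner ℂ (v p) x‖ ^ 2 := hu.norm_sum_sq_le s _
    _ ≤ ∑ p ∈ s, K ^ 2 * ‖inner ℂ (v p) x‖ ^ 2 := by
        refine Finset.sum_le_sum fun p hp => ?_
        rw [norm_mul, mul_pow, Complex.norm_real, Real.norm_eq_abs]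
        gcongr
        exact hc p hp
    _ ≤ (K * ‖x‖) ^ 2 := by
        rw [← Finset.mul_sum, mul_pow]
        gcongr
        exact hv.sum_norm_inner_sq_le s x

/-- A singular value decomposition, with `u p = 0` wherever the singular value vanishes. -/
theorem LinearMap.exists_singularValue_decomposition {F : Type*} [NormedAddCommGroup F]
    [InnerProductSpace ℂ F] [FiniteDimensional ℂ E] [FiniteDimensional ℂ F] (T : E →ₗ[ℂ] F) :
    ∃ (u : ℕ → F) (v : ℕ → E), SubOrthonormal u ∧ SubOrthonormal v ∧
      (∀ x, T x = ∑ p ∈ Finset.range (Module.finrank ℂ E),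
        (T.singularValues p : ℂ) • inner ℂ (v p) x • u p) ∧
      ∀ p, inner ℂ (u p) (T (v p)) = (T.singularValues p : ℂ) := by
  let b := T.isSymmetric_adjoint_comp_self.eigenvectorBasis rfl
  -- Zero padding keeps the family sub-orthonormal on all of ℕ.
  let v : ℕ → E := fun p => if h : p < Module.finrank ℂ E then b ⟨p, h⟩ else 0
  have hv : ∀ p (h : p < Module.finrank ℂ E), v p = b ⟨p, h⟩ := fun p h => dif_pos h
  have hv0 : ∀ p, ¬ p < Module.finrank ℂ E → v p = 0 := fun p h => dif_neg h
  have hvs : SubOrthonormal v := by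
    refine ⟨fun p => ?_, fun p q hpq => ?_⟩
    · by_cases h : p < Module.finrank ℂ E
      · rw [hv p h, b.norm_eq_one]
      · simp [hv0 p h]
    · by_cases h : p < Module.finrank ℂ E
      · by_cases h' : q < Module.finrank ℂ E
        · rw [hv p h, hv q h', b.inner_eq_zero]
          simpa using hpq
        · simp [hv0 q h']
      · simp [hv0 p h]
  have hT : ∀ p x, inner ℂ (T (v p)) (T x)
      = ((T.singularValues p : ℂ)) ^ 2 * inner ℂ (v p) x := by
    intro p x
    by_cases h : p < Module.finrank ℂ E
    · rw [← LinearMap.adjoint_inner_left, ← LinearMap.comp_apply, hv p h,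
        T.isSymmetric_adjoint_comp_self.apply_eigenvectorBasis rfl, inner_smul_left]
      have := T.sq_singularValues_fin rfl ⟨p, h⟩
      simp only at this
      rw [← this]
      simp [b]
    · simp [hv0 p h]
  have hnorm : ∀ p, T.singularValues p = 0 → T (v p) = 0 := by
    intro p h
    have := hT p (v p)
    rw [h] at this
    simpa using this
  -- The convention `0⁻¹ = 0` supplies the zero vectors `u p`.
  refine ⟨fun p => ((T.singularValues p : ℂ))⁻¹ • T (v p), v, ⟨fun p => ?_, fun p q hpq => ?_⟩,
    hvs, fun x => ?_, fun p => ?_⟩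
  · by_cases h : T.singularValues p = 0
    · simp [h]
    · have h1 := hT p (v p)
      rw [inner_self_eq_norm_sq_to_K, inner_self_eq_norm_sq_to_K] at h1
      have h2 : ‖T (v p)‖ ^ 2 = T.singularValues p ^ 2 * ‖v p‖ ^ 2 :=
        Complex.ofReal_injective (by push_cast; exact h1)
      have h3 : ‖T (v p)‖ ≤ T.singularValues p := by
        refine le_of_sq_le_sq ?_ (T.singularValues_nonneg p)
        rw [h2]
        exact mul_le_of_le_one_right (sq_nonneg _) (pow_le_one₀ (norm_nonneg _) (hvs.1 p))
      rw [norm_smul, norm_inv, Complex.norm_real, Real.norm_of_nonneg (T.singularValues_nonneg p)]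
      exact inv_mul_le_one_of_le₀ h3 (T.singularValues_nonneg p)
  · rw [inner_smul_left, inner_smul_right, hT, hvs.2 p q hpq]
    simp
  · have hx : x = ∑ p ∈ Finset.range (Module.finrank ℂ E), inner ℂ (v p) x • v p := by
      rw [Finset.sum_range]
      conv_lhs => rw [← b.sum_repr x]
      refine Finset.sum_congr rfl fun p _ => ?_
      rw [hv p p.2, b.repr_apply_apply]
    conv_lhs => rw [hx]
    rw [map_sum]
    refine Finset.sum_congr rfl fun p _ => ?_
    rw [map_smul]
    by_cases h : T.singularValues p = 0
    · simp [h, hnorm p h]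
    · have h' : (T.singularValues p : ℂ) ≠ 0 := by exact_mod_cast h
      rw [smul_comm _ (inner ℂ (v p) x), smul_smul (T.singularValues p : ℂ), mul_inv_cancel₀ h',
        one_smul]
  · by_cases h : T.singularValues p = 0
    · simp [h]
    · have h' : (T.singularValues p : ℂ) ≠ 0 := by exact_mod_cast h
      by_cases hp : p < Module.finrank ℂ E
      · rw [inner_smul_left, hT, hv p hp, inner_self_eq_norm_sq_to_K, b.norm_eq_one]
        simp
        field_simp
      · exact absurd (T.singularValues_of_finrank_le (not_lt.1 hp)) h

end SubOrthonormal

/-! ### The largest singular value as operator norm -/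

open scoped Matrix.Norms.L2Operator

theorem sigma_zero_eq_norm {m n : Type*} [Fintype m] [Fintype n] [DecidableEq n]
    (A : Matrix m n ℂ) : sigma A 0 = ‖A‖ := by
  obtain ⟨u, v, hu, hv, hA, hs⟩ := (Matrix.toEuclideanLin A).exists_singularValue_decomposition
  have h0 : 0 ≤ sigma A 0 := LinearMap.singularValues_nonneg _ 0
  apply le_antisymm
  · have h1 : ‖((sigma A 0 : ℝ) : ℂ)‖ ≤ ‖u 0‖ * ‖Matrix.toEuclideanLin A (v 0)‖ := by
      rw [sigma, ← hs 0]
      exact norm_inner_le_norm _ _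
    have h2 : ‖Matrix.toEuclideanLin A (v 0)‖ ≤ ‖A‖ * ‖v 0‖ := Matrix.l2_opNorm_mulVec A (v 0)
    rw [Complex.norm_real, Real.norm_of_nonneg h0] at h1
    calc _ ≤ _ := h1
      _ ≤ 1 * (‖A‖ * 1) := by
        gcongr
        · exact hu.1 0
        · exact h2.trans (by gcongr; exact hv.1 0)
      _ = ‖A‖ := by ring
  · rw [Matrix.l2_opNorm_def]
    refine ContinuousLinearMap.opNorm_le_bound _ h0 fun x => ?_
    change ‖Matrix.toEuclideanLin A x‖ ≤ _
    rw [hA x]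
    refine hu.norm_sum_inner_smul_le hv _ _ h0 (fun p _ => ?_) x
    rw [abs_of_nonneg (LinearMap.singularValues_nonneg _ p)]
    exact LinearMap.singularValues_antitone _ (Nat.zero_le p)

theorem Matrix.l2_opNorm_le_of_forall {m n : Type*} [Fintype m] [Fintype n] [DecidableEq n]
    (A : Matrix m n ℂ) {K : ℝ} (hK : 0 ≤ K)
    (h : ∀ x : EuclideanSpace ℂ n, ‖Matrix.toEuclideanLin A x‖ ≤ K * ‖x‖) : ‖A‖ ≤ K := by
  rw [Matrix.l2_opNorm_def]
  exact ContinuousLinearMap.opNorm_le_bound _ hK h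

theorem EuclideanSpace.norm_toLp_star {n : Type*} [Fintype n] (x : n → ℂ) :
    ‖WithLp.toLp 2 (star x)‖ = ‖WithLp.toLp 2 x‖ := by
  simp [EuclideanSpace.norm_eq]

theorem Matrix.l2_opNorm_map_star_le {m n : Type*} [Fintype m] [Fintype n] [DecidableEq n]
    (A : Matrix m n ℂ) : ‖A.map star‖ ≤ ‖A‖ := by
  refine Matrix.l2_opNorm_le_of_forall _ (norm_nonneg _) fun x => ?_
  have h : (A.map star) *ᵥ x.ofLp = star (A *ᵥ star x.ofLp) := by
    ext i
    simp [Matrix.mulVec, dotProduct]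
  rw [Matrix.toLpLin_apply, h, EuclideanSpace.norm_toLp_star]
  refine (Matrix.l2_opNorm_mulVec A (WithLp.toLp 2 (star x.ofLp))).trans ?_
  rw [EuclideanSpace.norm_toLp_star]

theorem Matrix.l2_opNorm_transpose_le {m n : Type*} [Fintype m] [Fintype n] [DecidableEq m]
    [DecidableEq n] (A : Matrix m n ℂ) : ‖Aᵀ‖ ≤ ‖A‖ := by
  have h : Aᵀ = (A.map star)ᴴ := by
    ext i j
    simp
  rw [h, Matrix.l2_opNorm_conjTranspose]
  exact A.l2_opNorm_map_star_le

/-! ### The factorization and the norm bound -/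

theorem fanPhi_mul_fanPsi {n : ℕ} (A B : Matrix (Fin n) (Fin n) ℂ) :
    fanPhi A * fanPsi B = fanProduct A B := by
  ext i m
  rw [Matrix.mul_apply, Fintype.sum_prod_type, Finset.sum_eq_single m, Finset.sum_eq_single i]
  · by_cases h : i = m
    · subst h
      simp [fanPhi, fanPsi, fanTheta, fanProduct]
    · simp [fanPhi, fanPsi, fanTheta, fanProduct, h]
  · intro l _ hl
    simp [fanPhi, fanTheta, Matrix.diagonal_apply_ne _ hl.symm]
  · simp
  · intro j _ hj
    simp [fanPsi, hj]
  · simp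

theorem Matrix.l2_opNorm_col_le {m n : Type*} [Fintype m] [Fintype n] [DecidableEq n]
    (A : Matrix m n ℂ) (j : n) : ∑ i, ‖A i j‖ ^ 2 ≤ ‖A‖ ^ 2 := by
  have h := Matrix.l2_opNorm_mulVec A (EuclideanSpace.single j 1)
  rw [PiLp.norm_single, norm_one, mul_one] at h
  have h2 := pow_le_pow_left₀ (norm_nonneg _) h 2
  rw [EuclideanSpace.norm_sq_eq] at h2
  simpa using h2

theorem norm_fanPsi_le {n : ℕ} (B : Matrix (Fin n) (Fin n) ℂ) : ‖fanPsi B‖ ≤ ‖B‖ := by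
  refine Matrix.l2_opNorm_le_of_forall _ (norm_nonneg _) fun x => ?_
  refine le_of_sq_le_sq ?_ (by positivity)
  rw [EuclideanSpace.norm_sq_eq, mul_pow, EuclideanSpace.norm_sq_eq, Fintype.sum_prod_type,
    Finset.mul_sum]
  refine Finset.sum_le_sum fun j _ => ?_
  have h : ∀ l, Matrix.toEuclideanLin (fanPsi B) x (j, l) = B l j * x j := by
    intro l
    simp [Matrix.toLpLin_apply, Matrix.mulVec, dotProduct, fanPsi]
  simp only [h, norm_mul, mul_pow, ← Finset.sum_mul]
  gcongr
  exact B.l2_opNorm_col_le j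

/-- The adjoint acts by disjoint scalings: ‖Φ(A)*x‖² = ∑_l (∑_j |a_lj|²)|x_l|², where the signs have
disappeared. The inner sums are squared column norms of Aᵀ. -/
theorem norm_fanPhi_le {n : ℕ} (A : Matrix (Fin n) (Fin n) ℂ) : ‖fanPhi A‖ ≤ ‖A‖ := by
  rw [← Matrix.l2_opNorm_conjTranspose]
  refine Matrix.l2_opNorm_le_of_forall _ (norm_nonneg _) fun x => ?_
  refine le_of_sq_le_sq ?_ (by positivity)
  rw [EuclideanSpace.norm_sq_eq, mul_pow, EuclideanSpace.norm_sq_eq, Fintype.sum_prod_type,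
    Finset.sum_comm, Finset.mul_sum]
  refine Finset.sum_le_sum fun l _ => ?_
  have h : ∀ j, ‖Matrix.toEuclideanLin (fanPhi A)ᴴ x (j, l)‖ = ‖A l j‖ * ‖x l‖ := by
    intro j
    have h1 : Matrix.toEuclideanLin (fanPhi A)ᴴ x (j, l)
        = star (Function.update (fun r => A r j) j (-A j j) l) * x l := by
      simp [Matrix.toLpLin_apply, Matrix.mulVec, dotProduct, fanPhi, fanTheta,
        Matrix.diagonal_apply, apply_ite, ite_mul]
    rw [h1, norm_mul, norm_star, Function.update_apply]
    split_ifs with h2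
    · rw [norm_neg, h2]
    · rfl
  simp only [h, mul_pow, ← Finset.sum_mul]
  gcongr
  have h2 := Aᵀ.l2_opNorm_col_le l
  exact h2.trans (pow_le_pow_left₀ (norm_nonneg _) A.l2_opNorm_transpose_le 2)

theorem norm_fanProduct_le {n : ℕ} (A B : Matrix (Fin n) (Fin n) ℂ) :
    ‖fanProduct A B‖ ≤ ‖A‖ * ‖B‖ := by
  rw [← fanPhi_mul_fanPsi]
  exact (Matrix.l2_opNorm_mul _ _).trans
    (mul_le_mul (norm_fanPhi_le A) (norm_fanPsi_le B) (norm_nonneg _) (norm_nonneg _))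

theorem trace_fanProduct_mul {n : ℕ} (A B C : Matrix (Fin n) (Fin n) ℂ) :
    (fanProduct A B * C).trace = (A * fanProduct Bᵀ C).trace := by
  simp only [Matrix.trace, Matrix.diag_apply, Matrix.mul_apply]
  refine Finset.sum_congr rfl fun i _ => Finset.sum_congr rfl fun j _ => ?_
  by_cases h : i = j
  · subst h
    simp [fanProduct]
    ring
  · simp [fanProduct, h, Ne.symm h]
    ring

/-- The trilinear form `∑ i j, (A ⋆ B)_{ij} C_{ij}`. -/
def fanForm {n : ℕ} (A B C : Matrix (Fin n) (Fin n) ℂ) : ℂ :=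
  ∑ i, ∑ j, fanProduct A B i j * C i j

/-! ### The symmetric trilinear form and rank-one arguments -/

section FanForm

variable {n : ℕ}

theorem fanProduct_comm (A B : Matrix (Fin n) (Fin n) ℂ) : fanProduct A B = fanProduct B A := by
  ext i j
  simp only [fanProduct, Matrix.of_apply]
  split_ifs <;> ring

theorem fanForm_comm (A B C : Matrix (Fin n) (Fin n) ℂ) : fanForm A B C = fanForm B A C := by
  rw [fanForm, fanProduct_comm, fanForm]

/-- The sign depends only on the position (i, j), so it can be moved to any factor. With
`fanForm_comm` this gives full symmetry. -/
theorem fanForm_right_comm (A B C : Matrix (Fin n) (Fin n) ℂ) :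
    fanForm A B C = fanForm A C B := by
  refine Finset.sum_congr rfl fun i _ => Finset.sum_congr rfl fun j _ => ?_
  simp only [fanProduct, Matrix.of_apply]
  split_ifs with h
  · subst h
    ring
  · ring

theorem fanForm_sum_right {ι : Type*} (A B : Matrix (Fin n) (Fin n) ℂ) (s : Finset ι)
    (C : ι → Matrix (Fin n) (Fin n) ℂ) :
    fanForm A B (∑ t ∈ s, C t) = ∑ t ∈ s, fanForm A B (C t) := by
  simp only [fanForm, Matrix.sum_apply, Finset.mul_sum]
  rw [Finset.sum_comm (s := s)]
  exact Finset.sum_congr rfl fun i _ => Finset.sum_comm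

theorem fanForm_sum_left {ι : Type*} (s : Finset ι) (A : ι → Matrix (Fin n) (Fin n) ℂ)
    (B C : Matrix (Fin n) (Fin n) ℂ) :
    fanForm (∑ t ∈ s, A t) B C = ∑ t ∈ s, fanForm (A t) B C := by
  rw [fanForm_comm, fanForm_right_comm, fanForm_sum_right]
  exact Finset.sum_congr rfl fun t _ => by rw [fanForm_right_comm, fanForm_comm]

theorem fanForm_sum_middle {ι : Type*} (s : Finset ι) (A C : Matrix (Fin n) (Fin n) ℂ)
    (B : ι → Matrix (Fin n) (Fin n) ℂ) :
    fanForm A (∑ t ∈ s, B t) C = ∑ t ∈ s, fanForm A (B t) C := by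
  rw [fanForm_right_comm, fanForm_sum_right]
  exact Finset.sum_congr rfl fun t _ => by rw [fanForm_right_comm]

theorem fanForm_smul_right (c : ℂ) (A B C : Matrix (Fin n) (Fin n) ℂ) :
    fanForm A B (c • C) = c * fanForm A B C := by
  simp only [fanForm, Matrix.smul_apply, smul_eq_mul, Finset.mul_sum]
  exact Finset.sum_congr rfl fun i _ => Finset.sum_congr rfl fun j _ => by ring

theorem fanForm_smul_middle (c : ℂ) (A B C : Matrix (Fin n) (Fin n) ℂ) :
    fanForm A (c • B) C = c * fanForm A B C := by
  rw [fanForm_right_comm, fanForm_smul_right, fanForm_right_comm]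

theorem fanForm_smul_left (c : ℂ) (A B C : Matrix (Fin n) (Fin n) ℂ) :
    fanForm (c • A) B C = c * fanForm A B C := by
  rw [fanForm_comm, fanForm_smul_middle, fanForm_comm]

/-- The operator `x ↦ ⟪v, x⟫ u` as a matrix. -/
def outer (u v : EuclideanSpace ℂ (Fin n)) : Matrix (Fin n) (Fin n) ℂ :=
  Matrix.vecMulVec u.ofLp (star v.ofLp)

theorem toEuclideanLin_outer (u v x : EuclideanSpace ℂ (Fin n)) :
    Matrix.toEuclideanLin (outer u v) x = inner ℂ v x • u := by
  ext i
  simp [outer, Matrix.toLpLin_apply, Matrix.mulVec, dotProduct, Matrix.vecMulVec_apply,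
    PiLp.inner_apply, Finset.sum_mul]
  exact Finset.sum_congr rfl fun j _ => by ring

theorem norm_sum_outer_le {u v : ℕ → EuclideanSpace ℂ (Fin n)} (hu : SubOrthonormal u)
    (hv : SubOrthonormal v) (s : Finset ℕ) : ‖∑ p ∈ s, outer (u p) (v p)‖ ≤ 1 := by
  refine Matrix.l2_opNorm_le_of_forall _ zero_le_one fun x => ?_
  rw [map_sum, LinearMap.sum_apply]
  simp only [toEuclideanLin_outer]
  simpa using hu.norm_sum_inner_smul_le hv s (fun _ => 1) zero_le_one (by simp) x

theorem eq_sum_smul_outer {A : Matrix (Fin n) (Fin n) ℂ} {u v : ℕ → EuclideanSpace ℂ (Fin n)}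
    {c : ℕ → ℂ} {s : Finset ℕ}
    (h : ∀ x, Matrix.toEuclideanLin A x = ∑ p ∈ s, c p • inner ℂ (v p) x • u p) :
    A = ∑ p ∈ s, c p • outer (u p) (v p) := by
  apply Matrix.toEuclideanLin.injective
  refine LinearMap.ext fun x => ?_
  rw [h, map_sum, LinearMap.sum_apply]
  refine Finset.sum_congr rfl fun p _ => ?_
  rw [map_smul, LinearMap.smul_apply, toEuclideanLin_outer]

theorem fanForm_map_star_outer (A B : Matrix (Fin n) (Fin n) ℂ)
    (u v : EuclideanSpace ℂ (Fin n)) :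
    fanForm A B ((outer u v).map star) =
      inner ℂ u (Matrix.toEuclideanLin (fanProduct A B) v) := by
  simp [fanForm, outer, Matrix.vecMulVec_apply, PiLp.inner_apply, Matrix.toLpLin_apply,
    Matrix.mulVec, dotProduct, Finset.sum_mul]
  exact Finset.sum_congr rfl fun i _ => Finset.sum_congr rfl fun j _ => by ring

theorem norm_fanForm_map_star_outer_le (A B : Matrix (Fin n) (Fin n) ℂ)
    {u v : EuclideanSpace ℂ (Fin n)} (hu : ‖u‖ ≤ 1) (hv : ‖v‖ ≤ 1) :
    ‖fanForm A B ((outer u v).map star)‖ ≤ ‖A‖ * ‖B‖ := by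
  rw [fanForm_map_star_outer]
  calc _ ≤ ‖u‖ * ‖Matrix.toEuclideanLin (fanProduct A B) v‖ := norm_inner_le_norm _ _
    _ ≤ 1 * (‖fanProduct A B‖ * ‖v‖) := by
        gcongr
        exact Matrix.l2_opNorm_mulVec _ v
    _ ≤ 1 * ((‖A‖ * ‖B‖) * 1) := by
        gcongr
        exact norm_fanProduct_le A B
    _ = _ := by ring

theorem norm_fanForm_star (A B C : Matrix (Fin n) (Fin n) ℂ) :
    ‖fanForm (A.map star) (B.map star) (C.map star)‖ = ‖fanForm A B C‖ := by
  rw [← norm_star (fanForm A B C)]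
  congr 1
  simp only [fanForm, star_sum]
  refine Finset.sum_congr rfl fun i _ => Finset.sum_congr rfl fun j _ => ?_
  simp only [fanProduct, Matrix.of_apply, Matrix.map_apply]
  split_ifs <;> simp

/-- Conjugating all three arguments conjugates the form, which reduces this to the conjugated
rank-one case. -/
theorem norm_fanForm_outer_le (A B : Matrix (Fin n) (Fin n) ℂ)
    {u v : EuclideanSpace ℂ (Fin n)} (hu : ‖u‖ ≤ 1) (hv : ‖v‖ ≤ 1) :
    ‖fanForm A B (outer u v)‖ ≤ ‖A‖ * ‖B‖ := by
  rw [← norm_fanForm_star]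
  refine (norm_fanForm_map_star_outer_le _ _ hu hv).trans ?_
  exact mul_le_mul A.l2_opNorm_map_star_le B.l2_opNorm_map_star_le (norm_nonneg _) (norm_nonneg _)

theorem norm_fanForm_sum_le (A B : Matrix (Fin n) (Fin n) ℂ) (hA : ‖A‖ ≤ 1) (hB : ‖B‖ ≤ 1)
    {u v : ℕ → EuclideanSpace ℂ (Fin n)} (hu : SubOrthonormal u) (hv : SubOrthonormal v) (k : ℕ) :
    ‖fanForm A B (∑ p ∈ Finset.range k, outer (u p) (v p))‖ ≤ k := by
  rw [fanForm_sum_right]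
  refine (norm_sum_le _ _).trans ?_
  refine (Finset.sum_le_sum fun p _ => (norm_fanForm_outer_le A B (hu.1 p) (hv.1 p)).trans
    (mul_le_one₀ hA (norm_nonneg _) hB)).trans ?_
  simp

theorem norm_fanForm_sum_map_star_le (A B : Matrix (Fin n) (Fin n) ℂ) (hA : ‖A‖ ≤ 1)
    (hB : ‖B‖ ≤ 1) {u v : ℕ → EuclideanSpace ℂ (Fin n)} (hu : SubOrthonormal u)
    (hv : SubOrthonormal v) (k : ℕ) :
    ‖fanForm A B (∑ p ∈ Finset.range k, (outer (u p) (v p)).map star)‖ ≤ k := by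
  rw [fanForm_sum_right]
  refine (norm_sum_le _ _).trans ?_
  refine (Finset.sum_le_sum fun p _ =>
    (norm_fanForm_map_star_outer_le A B (hu.1 p) (hv.1 p)).trans
    (mul_le_one₀ hA (norm_nonneg _) hB)).trans ?_
  simp

theorem norm_sum_map_star_outer_le {u v : ℕ → EuclideanSpace ℂ (Fin n)} (hu : SubOrthonormal u)
    (hv : SubOrthonormal v) (s : Finset ℕ) : ‖∑ p ∈ s, (outer (u p) (v p)).map star‖ ≤ 1 := by
  have h : ∑ p ∈ s, (outer (u p) (v p)).map star = (∑ p ∈ s, outer (u p) (v p)).map star := by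
    ext i j
    simp [Matrix.sum_apply]
  rw [h]
  exact (Matrix.l2_opNorm_map_star_le _).trans (norm_sum_outer_le hu hv s)

end FanForm

/-- Double summation by parts against partial sums bounded by `min P Q k`. -/
theorem sum_mul_mul_le_of_partialSums_le {n k : ℕ} (hk : k ≤ n) {α β : ℕ → ℝ} (hα : Antitone α)
    (hβ : Antitone β) (hα0 : α n = 0) (hβ0 : β n = 0) (M : ℕ → ℕ → ℝ)
    (hM : ∀ P Q, ∑ p ∈ Finset.range P, ∑ q ∈ Finset.range Q, M p q ≤ (min (min P Q) k : ℕ)) :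
    ∑ p ∈ Finset.range n, ∑ q ∈ Finset.range n, α p * β q * M p q ≤
      ∑ t ∈ Finset.range k, α t * β t := by
  -- Since γ vanishes at n, γ p telescopes over i ≥ p; the indicator lets the sums be exchanged.
  have tel : ∀ γ : ℕ → ℝ, γ n = 0 → ∀ p ∈ Finset.range n,
      γ p = ∑ i ∈ Finset.range n, if p < i + 1 then γ i - γ (i + 1) else 0 := by
    intro γ h0 p hp
    rw [← Finset.sum_filter]
    have : (Finset.range n).filter (fun i => p < i + 1) = Finset.Ico p n := by
      ext i
      simp
      omega
    rw [this]
    have h := Finset.sum_Ico_sub γ (Finset.mem_range.1 hp).le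
    rw [Finset.sum_sub_distrib] at h ⊢
    linarith
  have ind : ∀ (f : ℕ → ℝ) (i : ℕ), i ∈ Finset.range n →
      ∑ p ∈ Finset.range n, (if p < i + 1 then f p else 0) = ∑ p ∈ Finset.range (i + 1), f p := by
    intro f i hi
    rw [← Finset.sum_filter]
    refine Finset.sum_congr ?_ fun _ _ => rfl
    ext p
    simp at hi ⊢
    omega
  -- both sides expand along the increments of `α` and `β`
  have expand : ∀ N : ℕ → ℕ → ℝ,
      ∑ p ∈ Finset.range n, ∑ q ∈ Finset.range n, α p * β q * N p q =
        ∑ i ∈ Finset.range n, ∑ j ∈ Finset.range n, (α i - α (i + 1)) * (β j - β (j + 1)) *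
          ∑ p ∈ Finset.range (i + 1), ∑ q ∈ Finset.range (j + 1), N p q := by
    intro N
    have inner_expand : ∀ p, ∑ q ∈ Finset.range n, β q * N p q =
        ∑ j ∈ Finset.range n, (β j - β (j + 1)) * ∑ q ∈ Finset.range (j + 1), N p q := by
      intro p
      calc _ = ∑ q ∈ Finset.range n, ∑ j ∈ Finset.range n,
            (if q < j + 1 then (β j - β (j + 1)) * N p q else 0) := by
            refine Finset.sum_congr rfl fun q hq => ?_
            rw [tel β hβ0 q hq, Finset.sum_mul]
            exact Finset.sum_congr rfl fun j _ => by rw [ite_mul, zero_mul]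
        _ = _ := by
            rw [Finset.sum_comm]
            refine Finset.sum_congr rfl fun j hj => ?_
            rw [ind _ j hj, Finset.mul_sum]
    calc _ = ∑ p ∈ Finset.range n, α p * ∑ q ∈ Finset.range n, β q * N p q := by
          simp only [Finset.mul_sum, mul_assoc]
      _ = ∑ p ∈ Finset.range n, ∑ i ∈ Finset.range n, (if p < i + 1 then
            (α i - α (i + 1)) * ∑ q ∈ Finset.range n, β q * N p q else 0) := by
          refine Finset.sum_congr rfl fun p hp => ?_
          rw [tel α hα0 p hp, Finset.sum_mul]
          exact Finset.sum_congr rfl fun j _ => by rw [ite_mul, zero_mul]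
      _ = _ := by
          rw [Finset.sum_comm]
          refine Finset.sum_congr rfl fun i hi => ?_
          rw [ind _ i hi, ← Finset.mul_sum]
          simp only [inner_expand]
          rw [Finset.sum_comm, Finset.mul_sum]
          refine Finset.sum_congr rfl fun j _ => ?_
          rw [← Finset.mul_sum, mul_assoc]
  -- The right-hand side is the same double sum for the truncated identity, whose partial sums equal
  -- the bound min(P, Q, k).
  have diag : ∑ t ∈ Finset.range k, α t * β t = ∑ p ∈ Finset.range n, ∑ q ∈ Finset.range n,
      α p * β q * (if p = q ∧ p < k then 1 else 0) := by
    have : Finset.range k = (Finset.range n).filter (fun p => p < k) := by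
      ext p
      simp
      omega
    rw [this, Finset.sum_filter]
    refine Finset.sum_congr rfl fun p hp => ?_
    rw [Finset.sum_eq_single p]
    · simp
    · intro q _ hq
      simp [hq.symm]
    · exact fun h => absurd hp h
  rw [diag, expand, expand]
  refine Finset.sum_le_sum fun i _ => Finset.sum_le_sum fun j _ => ?_
  refine mul_le_mul_of_nonneg_left ((hM _ _).trans (le_of_eq ?_))
    (mul_nonneg (sub_nonneg.2 (hα (Nat.le_succ i))) (sub_nonneg.2 (hβ (Nat.le_succ j))))
  have : ∀ p ∈ Finset.range (i + 1),
      (∑ q ∈ Finset.range (j + 1), if p = q ∧ p < k then (1 : ℝ) else 0) =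
        if p < min (j + 1) k then 1 else 0 := by
    intro p _
    by_cases hpk : p < k <;> simp [hpk]
  rw [Finset.sum_congr rfl this, Finset.sum_boole]
  congr 1
  rw [← Finset.card_range (min (min (i + 1) (j + 1)) k)]
  congr 1
  ext p
  simp
  omega

/-! ### The Ky Fan sums and the theorem -/

theorem sum_sigma_fanProduct_le {n : ℕ} (A B : Matrix (Fin n) (Fin n) ℂ) {k : ℕ} (hk : k ≤ n) :
    ∑ i ∈ Finset.range k, sigma (fanProduct A B) i ≤
      ∑ i ∈ Finset.range k, sigma A i * sigma B i := by
  obtain ⟨u, v, hu, hv, hA, -⟩ := (Matrix.toEuclideanLin A).exists_singularValue_decomposition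
  obtain ⟨z, w, hz, hw, hB, -⟩ := (Matrix.toEuclideanLin B).exists_singularValue_decomposition
  obtain ⟨x, y, hx, hy, -, hs⟩ :=
    (Matrix.toEuclideanLin (fanProduct A B)).exists_singularValue_decomposition
  rw [finrank_euclideanSpace_fin] at hA hB
  have hA' := eq_sum_smul_outer hA
  have hB' := eq_sum_smul_outer hB
  -- Conjugation makes each term ⟪x_t, (A ⋆ B) y_t⟫, the t-th singular value.
  set C := ∑ t ∈ Finset.range k, (outer (x t) (y t)).map star with hC
  have hC1 : ‖C‖ ≤ 1 := norm_sum_map_star_outer_le hx hy _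
  have key : ∑ i ∈ Finset.range k, sigma (fanProduct A B) i = (fanForm A B C).re := by
    rw [hC, fanForm_sum_right, Complex.re_sum]
    refine Finset.sum_congr rfl fun t _ => ?_
    rw [fanForm_map_star_outer, hs, Complex.ofReal_re, sigma]
  have key2 : (fanForm A B C).re = ∑ p ∈ Finset.range n, ∑ q ∈ Finset.range n,
      sigma A p * sigma B q * (fanForm (outer (u p) (v p)) (outer (z q) (w q)) C).re := by
    conv_lhs => rw [hA', hB', fanForm_sum_left, Complex.re_sum]
    refine Finset.sum_congr rfl fun p _ => ?_
    rw [fanForm_sum_middle, Complex.re_sum]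
    refine Finset.sum_congr rfl fun q _ => ?_
    rw [fanForm_smul_left, fanForm_smul_middle, Complex.re_ofReal_mul, Complex.re_ofReal_mul,
      sigma, sigma, mul_assoc]
  rw [key, key2]
  refine sum_mul_mul_le_of_partialSums_le hk (LinearMap.singularValues_antitone _)
    (LinearMap.singularValues_antitone _) (LinearMap.singularValues_of_finrank_le _ (by simp))
    (LinearMap.singularValues_of_finrank_le _ (by simp)) _ fun P Q => ?_
  have hPQ : ∑ p ∈ Finset.range P, ∑ q ∈ Finset.range Q,
      (fanForm (outer (u p) (v p)) (outer (z q) (w q)) C).re =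
      (fanForm (∑ p ∈ Finset.range P, outer (u p) (v p))
        (∑ q ∈ Finset.range Q, outer (z q) (w q)) C).re := by
    simp only [fanForm_sum_left, fanForm_sum_middle, Complex.re_sum]
    exact Finset.sum_comm
  have hP := norm_sum_outer_le hu hv (Finset.range P)
  have hQ := norm_sum_outer_le hz hw (Finset.range Q)
  rw [hPQ]
  refine (Complex.re_le_norm _).trans ?_
  rw [Nat.cast_min, Nat.cast_min]
  -- Each bound moves one of the three sums to the last slot and counts its rank-one terms.
  refine le_min (le_min ?_ ?_) (norm_fanForm_sum_map_star_le _ _ hP hQ hx hy k)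
  · rw [fanForm_comm, fanForm_right_comm]
    exact norm_fanForm_sum_le _ _ hQ hC1 hu hv P
  · rw [fanForm_right_comm]
    exact norm_fanForm_sum_le _ _ hP hC1 hz hw Q

theorem mainTheorem3 (n : ℕ) (A B : Matrix (Fin n) (Fin n) ℂ) :
    (∀ C : Matrix (Fin n) (Fin n) ℂ,
      (fanProduct A B * C).trace = (A * fanProduct Bᵀ C).trace) ∧
    (fanProduct A B = fanPhi A * fanPsi B ∧
      sigma (fanPhi A) 0 ≤ sigma A 0 ∧ sigma (fanPsi B) 0 ≤ sigma B 0) ∧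
    sigma (fanProduct A B) 0 ≤ sigma A 0 * sigma B 0 ∧
    sigma (fanProduct Aᵀ B) 0 ≤ sigma A 0 * sigma B 0 ∧
    (∀ k : ℕ, 1 ≤ k → k ≤ n →
      ∑ i ∈ Finset.range k, sigma (fanProduct A B) i ≤
        ∑ i ∈ Finset.range k, sigma A i * sigma B i) := by 
  simp only [sigma_zero_eq_norm]
  refine ⟨trace_fanProduct_mul A B, ⟨(fanPhi_mul_fanPsi A B).symm, norm_fanPhi_le A,
    norm_fanPsi_le B⟩, norm_fanProduct_le A B, ?_, fun k _ hk => sum_sigma_fanProduct_le A B hk⟩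
  exact (norm_fanProduct_le Aᵀ B).trans
    (mul_le_mul_of_nonneg_right A.l2_opNorm_transpose_le (norm_nonneg _))
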